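/- Let $\mathcal{E}$ be a finitely bicomplete symmetric monoidal closed category with tensor unit $U$ and symmetry $\tau$. An \emph{interval} in $\mathcal{E}$ is a cocategory object (the dual of an internal category) whose object of coobjects is $U$; it has an object of coarrows $I$, maps $\bot,\top:U\to I$ (dual to domain and codomain), a coidentity $i:I\to U$, a pushout $I_2$ of $I$ with itself with $\downarrow\circ\top=\uparrow\circ\bot$ for the two injections $\downarrow,\uparrow:I\to I_2$, and a cocomposition $\star:I\to I_2$. Let $[h,k]:I_2\to X$ be the map with $[h,k]\circ{\downarrow}=h$ and $[h,k]\circ{\uparrow}=k$, and put $$\Delta=[(\bot\otimes I)\circ\lambda^{-1},\,(I\otimes\top)\circ\rho^{-1}]\circ\star:I\to I\otimes I .$$ A homotopy (2-cell) $f\Rightarrow g$ between maps $f,g:A\to B$ is a map $\eta:A\otimes I\to B$ with $\eta\circ(A\otimes\bot)=f\circ\rho$ and $\eta\circ(A\otimes\top)=g\circ\rho$. The vertical composite of $\eta:f\Rightarrow g$ and $\gamma:g\Rightarrow h$ is $[\eta,\gamma]\circ(A\otimes\star)$, with identities $f\circ\rho\circ(A\otimes i)$; this gives categories $\mathcal{E}(A,B)$.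 The horizontal composite of $\eta$ with a 2-cell $\gamma$ between maps $B\to C$ is $A\otimes I\xrightarrow{A\otimes\Delta}A\otimes(I\otimes I)\cong(A\otimes I)\otimes I\xrightarrow{\eta\otimes I}B\otimes I\xrightarrow{\gamma}C$. The interval is \emph{representable} if, with respect to this structure, every object $A$ has a cotensor $\mathbf{2}\pitchfork A$ with the category $\mathbf{2}=\{0\to1\}$, i.e. an object with isomorphisms of categories $\mathcal{E}(B,\mathbf{2}\pitchfork A)\cong\mathcal{E}(B,A)^{\mathbf{2}}$ that are 2-natural in $B$. A \emph{commutative Hopf object} (in the sense of Berger and Moerdijk) is a tuple $(H,\eta,m,\epsilon,\Delta)$ such that $(H,\eta,m)$ is a commutative monoid, $(H,\epsilon,\Delta)$ is a comonoid, and $m:H\otimes H\to H$ and $\eta:U\to H$ are comonoid homomorphisms, where $H\otimes H$ has the comonoid structure induced by the symmetry. \textbf{Corollary.} Let $I$ be a representable interval in $\mathcal{E}$. There are a unique map $\wedge:I\otimes I\to I$ such that both $\wedge$ and $\wedge\circ\tau$ are homotopies $\bot\circ i\Rightarrow 1_I$, and a unique map $\vee:I\otimes I\to I$ such that both $\vee$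 and $\vee\circ\tau$ are homotopies $1_I\Rightarrow\top\circ i$. With these maps, both $(I,\bot,\vee,i,\Delta)$ and $(I,\top,\wedge,i,\Delta)$ are commutative Hopf objects. -/

import Mathlib

open CategoryTheory MonoidalCategory Limits

universe v u

/-- A cocategory object in `E` whose object of coobjects is `C₀`: the dual of an internal category.
`bot`, `top` are the duals of domain and codomain, `coid` (written `i`) is the coidentity,
`down`, `up` are the duals of the two projections (`C₂` is the pushout of `C₁` with itself along
`top` and `bot`), `star` is cocomposition and `C₃` is the object of cocomposable triples. -/
structure CocategoryOn {E : Type u} [Category.{v} E] (C₀ : E) where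
  C₁ : E
  C₂ : E
  bot : C₀ ⟶ C₁
  top : C₀ ⟶ C₁
  coid : C₁ ⟶ C₀
  down : C₁ ⟶ C₂
  up : C₁ ⟶ C₂
  star : C₁ ⟶ C₂
  isPushout : IsPushout top bot down up
  bot_coid : bot ≫ coid = 𝟙 C₀
  top_coid : top ≫ coid = 𝟙 C₀
  bot_star : bot ≫ star = bot ≫ down
  top_star : top ≫ star = top ≫ up
  /-- `[⊥ ∘ i, 1] ∘ ⋆ = 1` -/
  counit_left : star ≫ isPushout.desc (coid ≫ bot) (𝟙 C₁)
    (by rw [← Category.assoc, top_coid, Category.id_comp, Category.comp_id]) = 𝟙 C₁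
  /-- `[1, ⊤ ∘ i] ∘ ⋆ = 1` -/
  counit_right : star ≫ isPushout.desc (𝟙 C₁) (coid ≫ top)
    (by rw [← Category.assoc, bot_coid, Category.id_comp, Category.comp_id]) = 𝟙 C₁
  C₃ : E
  ddown : C₂ ⟶ C₃
  uup : C₂ ⟶ C₃
  isPushout₃ : IsPushout up down ddown uup
  /-- `[⇓ ∘ ↓, ⇑ ∘ ⋆] ∘ ⋆ = [⇓ ∘ ⋆, ⇑ ∘ ↑] ∘ ⋆` -/
  coassoc :
    star ≫ isPushout.desc (down ≫ ddown) (star ≫ uup)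
      (by rw [← Category.assoc bot, bot_star, Category.assoc, ← isPushout₃.w,
        ← Category.assoc, isPushout.w, Category.assoc]) =
    star ≫ isPushout.desc (star ≫ ddown) (up ≫ uup)
      (by rw [← Category.assoc top, top_star, Category.assoc, isPushout₃.w,
        ← Category.assoc, isPushout.w, Category.assoc])

/-- A (strict) interval: a cocategory object whose object of coobjects is the tensor unit. -/
abbrev StrictInterval (E : Type u) [Category.{v} E] [MonoidalCategory E] :=
  CocategoryOn (𝟙_ E)

namespace StrictInterval

section Comonoid

variable {E : Type u} [Category.{v} E] [MonoidalCategory E] (I : StrictInterval E)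

/-- The comultiplication `Δ = [(⊥ ⊗ I) ∘ λ⁻¹, (I ⊗ ⊤) ∘ ρ⁻¹] ∘ ⋆` of an interval. -/
noncomputable def comul : I.C₁ ⟶ I.C₁ ⊗ I.C₁ :=
  I.star ≫ I.isPushout.desc ((λ_ I.C₁).inv ≫ I.bot ▷ I.C₁) ((ρ_ I.C₁).inv ≫ I.C₁ ◁ I.top)
    (by
      rw [leftUnitor_inv_naturality_assoc, rightUnitor_inv_naturality_assoc,
        whisker_exchange, unitors_inv_equal])

theorem bot_comul : I.bot ≫ I.comul = I.bot ≫ (λ_ I.C₁).inv ≫ I.bot ▷ I.C₁ := by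
  rw [comul, ← Category.assoc, I.bot_star, Category.assoc, IsPushout.inl_desc]

theorem top_comul : I.top ≫ I.comul = I.top ≫ (ρ_ I.C₁).inv ≫ I.C₁ ◁ I.top := by
  rw [comul, ← Category.assoc, I.top_star, Category.assoc, IsPushout.inr_desc]

end Comonoid

section Homotopy

variable {E : Type u} [Category.{v} E] [MonoidalCategory E] (I : StrictInterval E)

/-- A homotopy `f ⇒ g` with respect to `I`: a map `A ⊗ I ⟶ B` which restricts to `f` along `⊥`
and to `g` along `⊤`. -/
@[ext]
structure Homotopy {A B : E} (f g : A ⟶ B) where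
  map : A ⊗ I.C₁ ⟶ B
  dom : A ◁ I.bot ≫ map = (ρ_ A).hom ≫ f
  cod : A ◁ I.top ≫ map = (ρ_ A).hom ≫ g

/-- The objects of the category `E(A, B)` of maps and homotopies: the maps `A ⟶ B`. -/
structure HomCat {E : Type u} [Category.{v} E] [MonoidalCategory E] (I : StrictInterval E)
    (A B : E) where
  map : A ⟶ B

variable {I}

/-- The identity homotopy of `f`, namely `f ∘ ρ ∘ (A ⊗ i)`. -/
def Homotopy.refl {A B : E} (f : A ⟶ B) : I.Homotopy f f where
  map := A ◁ I.coid ≫ (ρ_ A).hom ≫ f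
  dom := by rw [← whiskerLeft_comp_assoc, I.bot_coid, whiskerLeft_id, Category.id_comp]
  cod := by rw [← whiskerLeft_comp_assoc, I.top_coid, whiskerLeft_id, Category.id_comp]

/-- The horizontal composite `γ * η`, namely `γ ∘ (η ⊗ I) ∘ α ∘ (A ⊗ Δ)`. -/
noncomputable def Homotopy.hcomp {A B C : E} {f g : A ⟶ B} {h k : B ⟶ C}
    (η : I.Homotopy f g) (γ : I.Homotopy h k) : I.Homotopy (f ≫ h) (g ≫ k) where
  map := A ◁ I.comul ≫ (α_ A I.C₁ I.C₁).inv ≫ η.map ▷ I.C₁ ≫ γ.map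
  dom := by
    have h₁ : A ◁ (λ_ I.C₁).inv ≫ (α_ A (𝟙_ E) I.C₁).inv ≫ (ρ_ A).hom ▷ I.C₁ = 𝟙 _ := by
      monoidal
    rw [← whiskerLeft_comp_assoc, I.bot_comul, whiskerLeft_comp, whiskerLeft_comp]
    simp only [Category.assoc]
    rw [associator_inv_naturality_middle_assoc, ← comp_whiskerRight_assoc, η.dom,
      comp_whiskerRight_assoc, reassoc_of% h₁, whisker_exchange_assoc, γ.dom,
      rightUnitor_naturality_assoc]
  cod := by
    have h₁ : A ◁ (ρ_ I.C₁).inv ≫ (α_ A I.C₁ (𝟙_ E)).inv ≫ (ρ_ (A ⊗ I.C₁)).hom = 𝟙 _ := by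
      monoidal
    rw [← whiskerLeft_comp_assoc, I.top_comul, whiskerLeft_comp, whiskerLeft_comp]
    simp only [Category.assoc]
    rw [associator_inv_naturality_right_assoc, whisker_exchange_assoc, γ.cod,
      rightUnitor_naturality_assoc, reassoc_of% h₁, reassoc_of% η.cod]

variable [MonoidalClosed E]

/-- Tensoring with `A` preserves the pushout defining `C₂`. -/
theorem isPushout_whiskerLeft (A : E) :
    IsPushout (A ◁ I.top) (A ◁ I.bot) (A ◁ I.down) (A ◁ I.up) :=
  I.isPushout.map (tensorLeft A)

/-- Tensoring with `A` preserves the pushout defining `C₃`. -/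
theorem isPushout₃_whiskerLeft (A : E) :
    IsPushout (A ◁ I.up) (A ◁ I.down) (A ◁ I.ddown) (A ◁ I.uup) :=
  I.isPushout₃.map (tensorLeft A)

/-- The vertical composite of `η : f ⇒ g` and `γ : g ⇒ h`, namely `[η, γ] ∘ (A ⊗ ⋆)`. -/
noncomputable def Homotopy.vcomp {A B : E} {f g h : A ⟶ B}
    (η : I.Homotopy f g) (γ : I.Homotopy g h) : I.Homotopy f h where
  map := A ◁ I.star ≫ (isPushout_whiskerLeft A).desc η.map γ.map (η.cod.trans γ.dom.symm)
  dom := by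
    rw [← whiskerLeft_comp_assoc, I.bot_star, whiskerLeft_comp_assoc, IsPushout.inl_desc, η.dom]
  cod := by
    rw [← whiskerLeft_comp_assoc, I.top_star, whiskerLeft_comp_assoc, IsPushout.inr_desc, γ.cod]

theorem Homotopy.refl_vcomp {A B : E} {f g : A ⟶ B} (γ : I.Homotopy f g) :
    (Homotopy.refl f).vcomp γ = γ := by
  ext
  have h : (isPushout_whiskerLeft A).desc (Homotopy.refl f).map γ.map
      ((Homotopy.refl f).cod.trans γ.dom.symm) =
      A ◁ I.isPushout.desc (I.coid ≫ I.bot) (𝟙 I.C₁)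
        (by rw [← Category.assoc, I.top_coid, Category.id_comp, Category.comp_id]) ≫ γ.map := by
    apply (isPushout_whiskerLeft A).hom_ext
    · rw [IsPushout.inl_desc, ← whiskerLeft_comp_assoc, IsPushout.inl_desc,
        whiskerLeft_comp_assoc, γ.dom]
      rfl
    · rw [IsPushout.inr_desc, ← whiskerLeft_comp_assoc, IsPushout.inr_desc, whiskerLeft_id,
        Category.id_comp]
  change A ◁ I.star ≫ _ = _
  rw [h, ← whiskerLeft_comp_assoc, I.counit_left, whiskerLeft_id, Category.id_comp]

theorem Homotopy.vcomp_refl {A B : E} {f g : A ⟶ B} (γ : I.Homotopy f g) :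
    γ.vcomp (Homotopy.refl g) = γ := by
  ext
  have h : (isPushout_whiskerLeft A).desc γ.map (Homotopy.refl g).map
      (γ.cod.trans (Homotopy.refl g).dom.symm) =
      A ◁ I.isPushout.desc (𝟙 I.C₁) (I.coid ≫ I.top)
        (by rw [← Category.assoc, I.bot_coid, Category.id_comp, Category.comp_id]) ≫ γ.map := by
    apply (isPushout_whiskerLeft A).hom_ext
    · rw [IsPushout.inl_desc, ← whiskerLeft_comp_assoc, IsPushout.inl_desc, whiskerLeft_id,
        Category.id_comp]
    · rw [IsPushout.inr_desc, ← whiskerLeft_comp_assoc, IsPushout.inr_desc,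
        whiskerLeft_comp_assoc, γ.cod]
      rfl
  change A ◁ I.star ≫ _ = _
  rw [h, ← whiskerLeft_comp_assoc, I.counit_right, whiskerLeft_id, Category.id_comp]

theorem Homotopy.vcomp_assoc {A B : E} {f g h k : A ⟶ B} (η : I.Homotopy f g)
    (γ : I.Homotopy g h) (θ : I.Homotopy h k) :
    (η.vcomp γ).vcomp θ = η.vcomp (γ.vcomp θ) := by
  ext
  obtain ⟨T, hT₁, hT₂⟩ := (isPushout₃_whiskerLeft (I := I) A).exists_desc
    ((isPushout_whiskerLeft A).desc η.map γ.map (η.cod.trans γ.dom.symm))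
    ((isPushout_whiskerLeft A).desc γ.map θ.map (γ.cod.trans θ.dom.symm))
    (by rw [IsPushout.inr_desc, IsPushout.inl_desc])
  have h₁ : (isPushout_whiskerLeft A).desc (η.vcomp γ).map θ.map
      ((η.vcomp γ).cod.trans θ.dom.symm) =
      A ◁ I.isPushout.desc (I.star ≫ I.ddown) (I.up ≫ I.uup)
        (by rw [← Category.assoc I.top, I.top_star, Category.assoc, I.isPushout₃.w,
          ← Category.assoc, I.isPushout.w, Category.assoc]) ≫ T := by
    apply (isPushout_whiskerLeft A).hom_ext
    · rw [IsPushout.inl_desc, ← whiskerLeft_comp_assoc, IsPushout.inl_desc,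
        whiskerLeft_comp_assoc, hT₁]
      rfl
    · rw [IsPushout.inr_desc, ← whiskerLeft_comp_assoc, IsPushout.inr_desc,
        whiskerLeft_comp_assoc, hT₂, IsPushout.inr_desc]
  have h₂ : (isPushout_whiskerLeft A).desc η.map (γ.vcomp θ).map
      (η.cod.trans (γ.vcomp θ).dom.symm) =
      A ◁ I.isPushout.desc (I.down ≫ I.ddown) (I.star ≫ I.uup)
        (by rw [← Category.assoc I.bot, I.bot_star, Category.assoc, ← I.isPushout₃.w,
          ← Category.assoc, I.isPushout.w, Category.assoc]) ≫ T := by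
    apply (isPushout_whiskerLeft A).hom_ext
    · rw [IsPushout.inl_desc, ← whiskerLeft_comp_assoc, IsPushout.inl_desc,
        whiskerLeft_comp_assoc, hT₁, IsPushout.inl_desc]
    · rw [IsPushout.inr_desc, ← whiskerLeft_comp_assoc, IsPushout.inr_desc,
        whiskerLeft_comp_assoc, hT₂]
      rfl
  change A ◁ I.star ≫ _ = A ◁ I.star ≫ _
  rw [h₁, h₂, ← whiskerLeft_comp_assoc, ← whiskerLeft_comp_assoc, I.coassoc]

/-- The category `E(A, B)` of maps `A ⟶ B` and homotopies with respect to `I`. -/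
noncomputable instance (A B : E) : Category (I.HomCat A B) where
  Hom f g := I.Homotopy f.map g.map
  id f := Homotopy.refl f.map
  comp η γ := η.vcomp γ
  id_comp := Homotopy.refl_vcomp
  comp_id := Homotopy.vcomp_refl
  assoc := Homotopy.vcomp_assoc

end Homotopy

section Representable

variable {E : Type u} [Category.{v} E] [MonoidalCategory E] [MonoidalClosed E]

/-- `P` is a cotensor `𝟐 ⋔ A` of `A` with the category `𝟐`, with respect to the 2-dimensional
structure on `E` induced by `I`: an isomorphism of categories `E(B, P) ≅ E(B, A)^𝟐` for every `B`
(the category of functors from `𝟐` is the arrow category), 2-natural in `B`.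
An object of `E(B, A)^𝟐` is determined by the map `B ⊗ I ⟶ A` underlying it, and a homotopy by its
underlying map, so that naturality is stated for underlying maps. -/
structure Cotensor (I : StrictInterval E) (A P : E) where
  /-- the isomorphism `E(B, P) ⥤ E(B, A)^𝟐` -/
  toArrow (B : E) : I.HomCat B P ⥤ Arrow (I.HomCat B A)
  /-- its inverse -/
  ofArrow (B : E) : Arrow (I.HomCat B A) ⥤ I.HomCat B P
  toArrow_ofArrow (B : E) : toArrow B ⋙ ofArrow B = 𝟭 _
  ofArrow_toArrow (B : E) : ofArrow B ⋙ toArrow B = 𝟭 _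
  /-- naturality on objects: precomposition with `u : B' ⟶ B` -/
  naturality_obj {B' B : E} (u : B' ⟶ B) (f : I.HomCat B P) :
    ((toArrow B').obj ⟨u ≫ f.map⟩).hom.map =
      ((Homotopy.refl u).hcomp ((toArrow B).obj f).hom).map
  /-- naturality on arrows: horizontal composition with `θ : u ⇒ u'` (first component) -/
  naturality_left {B' B : E} {u u' : B' ⟶ B} (θ : I.Homotopy u u') {f g : I.HomCat B P}
    (φ : f ⟶ g) :
    ((toArrow B').map (X := ⟨u ≫ f.map⟩) (Y := ⟨u' ≫ g.map⟩) (θ.hcomp φ)).left.map =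
      (θ.hcomp ((toArrow B).map φ).left).map
  /-- naturality on arrows: horizontal composition with `θ : u ⇒ u'` (second component) -/
  naturality_right {B' B : E} {u u' : B' ⟶ B} (θ : I.Homotopy u u') {f g : I.HomCat B P}
    (φ : f ⟶ g) :
    ((toArrow B').map (X := ⟨u ≫ f.map⟩) (Y := ⟨u' ≫ g.map⟩) (θ.hcomp φ)).right.map =
      (θ.hcomp ((toArrow B).map φ).right).map

/-- An interval is representable if all cotensors with `𝟐` exist with respect to the 2-dimensional
structure it induces. -/
def IsRepresentable (I : StrictInterval E) : Prop :=
  ∀ A : E, ∃ P : E, Nonempty (I.Cotensor A P)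

end Representable

section Lattice

variable {E : Type u} [Category.{v} E] [MonoidalCategory E] [SymmetricCategory E]

/-- `m` is a meet operation: both `m` and `m ∘ τ` are homotopies `⊥ ∘ i ⇒ 1`. -/
def IsMeet (I : StrictInterval E) (m : I.C₁ ⊗ I.C₁ ⟶ I.C₁) : Prop :=
  (∃ η : I.Homotopy (I.coid ≫ I.bot) (𝟙 I.C₁), η.map = m) ∧
    ∃ η : I.Homotopy (I.coid ≫ I.bot) (𝟙 I.C₁), η.map = (β_ I.C₁ I.C₁).hom ≫ m

/-- `j` is a join operation: both `j` and `j ∘ τ` are homotopies `1 ⇒ ⊤ ∘ i`. -/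
def IsJoin (I : StrictInterval E) (j : I.C₁ ⊗ I.C₁ ⟶ I.C₁) : Prop :=
  (∃ η : I.Homotopy (𝟙 I.C₁) (I.coid ≫ I.top), η.map = j) ∧
    ∃ η : I.Homotopy (𝟙 I.C₁) (I.coid ≫ I.top), η.map = (β_ I.C₁ I.C₁).hom ≫ j

end Lattice

end StrictInterval

open scoped MonObj ComonObj in
/-- `(H, e, m, c, d)` is a commutative Hopf object in the sense of Berger and Moerdijk: `(H, e, m)`
is a commutative monoid, `(H, c, d)` is a comonoid, and `m` and `e` are comonoid homomorphisms (there
is no antipode, so this is what Mathlib calls a bimonoid object). -/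
def IsCommHopfObject {E : Type u} [Category.{v} E] [MonoidalCategory E] [SymmetricCategory E]
    (H : E) (e : 𝟙_ E ⟶ H) (m : H ⊗ H ⟶ H) (c : H ⟶ 𝟙_ E) (d : H ⟶ H ⊗ H) : Prop :=
  ∃ _ : BimonObj H, IsCommMonObj H ∧ η[H] = e ∧ μ[H] = m ∧ ε[H] = c ∧ Δ[H] = d

/-!
A cotensor `P` of `A` with `𝟐` is in particular an internal hom `[I, A]`: on objects, the isomorphism
of categories `E(B, P) ≅ E(B, A)^𝟐` identifies maps `B ⟶ P` with homotopies `B ⊗ I ⟶ A`, and every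
map `B ⊗ I ⟶ A` is a homotopy between its restrictions to the endpoints. On arrows it then says
that a map `(B ⊗ I) ⊗ I ⟶ A` is the same thing as a commutative square of homotopies, given by the
four restrictions of the map along the endpoints of the two copies of `I`. The content is in two
statements:

* such a map is determined by its restrictions to the boundary (`Cotensor.square_ext`);
* every commutative square of homotopies is filled by such a map (`Cotensor.exists_square`).

2-naturality is what identifies the components of the square with the restrictions along the
endpoints of the last copy of `I` (`Cotensor.toArrow_map_left_map`, `toArrow_map_right_map`).

Write `u : ⊥ ⇒ ⊤` for the homotopy given by the identity of `I`. The meet fills the square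
`𝟙 ≫ u = 𝟙 ≫ u` and the join fills `u ≫ 𝟙 = u ≫ 𝟙`. Being a meet or a join prescribes the whole
boundary, whence uniqueness. Commutativity, associativity and the compatibility of the operation
with `Δ` and `i` are equations between maps out of `I ⊗ I` or `(I ⊗ I) ⊗ I`, and it suffices to
check them on the boundary, where one argument is an endpoint: one endpoint is neutral, the other
one absorbing (`IsConnection`).

The comonoid axioms for `(I, i, Δ)` hold for every interval. Here `Δ` is the concatenation of the
paths `(⊥, -)` and `(-, ⊤)` in `I ⊗ I`, and both iterated comultiplications are threefold
concatenations of `(⊥, ⊥, -)`, `(⊥, -, ⊤)` and `(-, ⊤, ⊤)`, bracketed differently.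
-/

/-! ### Concatenation of paths and the comonoid structure -/

namespace StrictInterval

section Comonoid

variable {E : Type u} [Category.{v} E] [MonoidalCategory E] (I : StrictInterval E)

/-- The concatenation of two paths `f g : I ⟶ X` such that `f` ends where `g` starts. -/
noncomputable def concat {X : E} (f g : I.C₁ ⟶ X) (w : I.top ≫ f = I.bot ≫ g) : I.C₁ ⟶ X :=
  I.star ≫ I.isPushout.desc f g w

variable {I}

theorem concat_comp {X Y : E} (f g : I.C₁ ⟶ X) (w : I.top ≫ f = I.bot ≫ g) (k : X ⟶ Y) :
    I.concat f g w ≫ k = I.concat (f ≫ k) (g ≫ k) (by rw [reassoc_of% w]) := by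
  rw [concat, concat, Category.assoc]
  congr 1
  apply I.isPushout.hom_ext <;> simp

theorem top_concat {X : E} (f g : I.C₁ ⟶ X) (w : I.top ≫ f = I.bot ≫ g) :
    I.top ≫ I.concat f g w = I.top ≫ g := by
  rw [concat, ← Category.assoc, I.top_star, Category.assoc, IsPushout.inr_desc]

theorem bot_concat {X : E} (f g : I.C₁ ⟶ X) (w : I.top ≫ f = I.bot ≫ g) :
    I.bot ≫ I.concat f g w = I.bot ≫ f := by
  rw [concat, ← Category.assoc, I.bot_star, Category.assoc, IsPushout.inl_desc]

theorem concat_assoc {X : E} (f g h : I.C₁ ⟶ X) (w₁ : I.top ≫ f = I.bot ≫ g)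
    (w₂ : I.top ≫ g = I.bot ≫ h) :
    I.concat (I.concat f g w₁) h ((top_concat f g w₁).trans w₂) =
      I.concat f (I.concat g h w₂) (w₁.trans (bot_concat g h w₂).symm) := by
  obtain ⟨T, hT₁, hT₂⟩ := I.isPushout₃.exists_desc (I.isPushout.desc f g w₁)
    (I.isPushout.desc g h w₂) (by simp)
  have h₁ : I.isPushout.desc (I.concat f g w₁) h ((top_concat f g w₁).trans w₂) =
      I.isPushout.desc (I.star ≫ I.ddown) (I.up ≫ I.uup)
        (by rw [← Category.assoc I.top, I.top_star, Category.assoc, I.isPushout₃.w,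
          ← Category.assoc, I.isPushout.w, Category.assoc]) ≫ T := by
    apply I.isPushout.hom_ext <;> simp [hT₁, hT₂, concat]
  have h₂ : I.isPushout.desc f (I.concat g h w₂) (w₁.trans (bot_concat g h w₂).symm) =
      I.isPushout.desc (I.down ≫ I.ddown) (I.star ≫ I.uup)
        (by rw [← Category.assoc I.bot, I.bot_star, Category.assoc, ← I.isPushout₃.w,
          ← Category.assoc, I.isPushout.w, Category.assoc]) ≫ T := by
    apply I.isPushout.hom_ext <;> simp [hT₁, hT₂, concat]
  rw [concat, h₁, concat, h₂]
  simpa only [Category.assoc] using congrArg (· ≫ T) I.coassoc.symm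

theorem const_concat {X : E} (x : 𝟙_ E ⟶ X) (f : I.C₁ ⟶ X)
    (w : I.top ≫ I.coid ≫ x = I.bot ≫ f) : I.concat (I.coid ≫ x) f w = f := by
  have hx : I.bot ≫ f = x := by rw [← w, ← Category.assoc, I.top_coid, Category.id_comp]
  have h : I.isPushout.desc (I.coid ≫ x) f w = I.isPushout.desc (I.coid ≫ I.bot) (𝟙 I.C₁)
      (by rw [← Category.assoc, I.top_coid, Category.id_comp, Category.comp_id]) ≫ f := by
    apply I.isPushout.hom_ext <;> simp [hx]
  rw [concat, h, ← Category.assoc, I.counit_left, Category.id_comp]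

theorem concat_const {X : E} (f : I.C₁ ⟶ X) (x : 𝟙_ E ⟶ X)
    (w : I.top ≫ f = I.bot ≫ I.coid ≫ x) : I.concat f (I.coid ≫ x) w = f := by
  have hx : I.top ≫ f = x := by rw [w, ← Category.assoc, I.bot_coid, Category.id_comp]
  have h : I.isPushout.desc f (I.coid ≫ x) w = I.isPushout.desc (𝟙 I.C₁) (I.coid ≫ I.top)
      (by rw [← Category.assoc, I.bot_coid, Category.id_comp, Category.comp_id]) ≫ f := by
    apply I.isPushout.hom_ext <;> simp [hx]
  rw [concat, h, ← Category.assoc, I.counit_right, Category.id_comp]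

/-- Rewriting the paths inside `concat` directly would fail, since the matching condition mentions
them. -/
theorem concat_congr {X : E} {f f' g g' : I.C₁ ⟶ X} (hf : f = f') (hg : g = g')
    (w : I.top ≫ f = I.bot ≫ g) : I.concat f g w = I.concat f' g' (by rw [← hf, ← hg, w]) := by
  subst hf hg; rfl

variable (I)

theorem comul_comp {X : E} (k : I.C₁ ⊗ I.C₁ ⟶ X) :
    I.comul ≫ k = I.concat (((λ_ I.C₁).inv ≫ I.bot ▷ I.C₁) ≫ k)
      (((ρ_ I.C₁).inv ≫ I.C₁ ◁ I.top) ≫ k) (by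
        simp only [leftUnitor_inv_naturality_assoc, rightUnitor_inv_naturality_assoc,
          whisker_exchange_assoc, unitors_inv_equal, Category.assoc]) :=
  concat_comp _ _ _ k

theorem comul_counit_left : I.comul ≫ I.coid ▷ I.C₁ = (λ_ I.C₁).inv := by
  have h₁ : ((λ_ I.C₁).inv ≫ I.bot ▷ I.C₁) ≫ I.coid ▷ I.C₁ = (λ_ I.C₁).inv := by
    simp [← comp_whiskerRight, I.bot_coid]
  have h₂ : ((ρ_ I.C₁).inv ≫ I.C₁ ◁ I.top) ≫ I.coid ▷ I.C₁ =
      I.coid ≫ I.top ≫ (λ_ I.C₁).inv := by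
    simp only [Category.assoc, whisker_exchange, ← rightUnitor_inv_naturality_assoc,
      leftUnitor_inv_naturality, unitors_inv_equal]
  rw [comul_comp, concat_congr h₁ h₂, concat_const]

theorem comul_counit_right : I.comul ≫ I.C₁ ◁ I.coid = (ρ_ I.C₁).inv := by
  have h₁ : ((λ_ I.C₁).inv ≫ I.bot ▷ I.C₁) ≫ I.C₁ ◁ I.coid =
      I.coid ≫ I.bot ≫ (ρ_ I.C₁).inv := by
    simp only [Category.assoc, ← whisker_exchange, ← leftUnitor_inv_naturality_assoc,
      rightUnitor_inv_naturality, unitors_inv_equal]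
  have h₂ : ((ρ_ I.C₁).inv ≫ I.C₁ ◁ I.top) ≫ I.C₁ ◁ I.coid = (ρ_ I.C₁).inv := by
    simp [← whiskerLeft_comp, I.top_coid]
  rw [comul_comp, concat_congr h₁ h₂, const_concat]

/-- `Δ ≫ (I ◁ Δ)` is `xyz` bracketed as `(xy)z` and `Δ ≫ (Δ ▷ I)` is `x(yz)`, for the paths
`x = (⊥, ⊥, -)`, `y = (⊥, -, ⊤)` and `z = (-, ⊤, ⊤)`. -/
theorem comul_coassoc :
    I.comul ≫ I.C₁ ◁ I.comul = I.comul ≫ I.comul ▷ I.C₁ ≫ (α_ I.C₁ I.C₁ I.C₁).hom := by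
  have l₁ : ((λ_ I.C₁).inv ≫ I.bot ▷ I.C₁) ≫ I.C₁ ◁ I.comul =
      I.comul ≫ (λ_ _).inv ≫ I.bot ▷ (I.C₁ ⊗ I.C₁) := by
    simp only [Category.assoc, ← whisker_exchange, ← leftUnitor_inv_naturality_assoc]
  have r₂ : ((ρ_ I.C₁).inv ≫ I.C₁ ◁ I.top) ≫ I.comul ▷ I.C₁ ≫ (α_ I.C₁ I.C₁ I.C₁).hom =
      I.comul ≫ (ρ_ _).inv ≫ (I.C₁ ⊗ I.C₁) ◁ I.top ≫ (α_ I.C₁ I.C₁ I.C₁).hom := by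
    simp only [Category.assoc, whisker_exchange_assoc, ← rightUnitor_inv_naturality_assoc]
  have ex : ((λ_ I.C₁).inv ≫ I.bot ▷ I.C₁) ≫ I.C₁ ◁ I.comul =
      I.concat _ _ _ := l₁.trans (by rw [comul_comp])
  have ey : ((ρ_ I.C₁).inv ≫ I.C₁ ◁ I.top) ≫ I.comul ▷ I.C₁ ≫ (α_ I.C₁ I.C₁ I.C₁).hom =
      I.concat _ _ _ := r₂.trans (by rw [comul_comp])
  have hx : ((λ_ I.C₁).inv ≫ I.bot ▷ I.C₁) ≫ I.comul ▷ I.C₁ ≫ (α_ I.C₁ I.C₁ I.C₁).hom =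
      ((λ_ I.C₁).inv ≫ I.bot ▷ I.C₁) ≫ (λ_ _).inv ≫ I.bot ▷ (I.C₁ ⊗ I.C₁) := by
    rw [Category.assoc, ← comp_whiskerRight_assoc, I.bot_comul]
    monoidal
  have hz : ((ρ_ I.C₁).inv ≫ I.C₁ ◁ I.top) ≫ I.C₁ ◁ I.comul =
      ((ρ_ I.C₁).inv ≫ I.C₁ ◁ I.top) ≫ (ρ_ _).inv ≫
        (I.C₁ ⊗ I.C₁) ◁ I.top ≫ (α_ I.C₁ I.C₁ I.C₁).hom := by
    rw [Category.assoc, ← whiskerLeft_comp, I.top_comul]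
    monoidal
  have hy : ((ρ_ I.C₁).inv ≫ I.C₁ ◁ I.top) ≫ (λ_ _).inv ≫ I.bot ▷ (I.C₁ ⊗ I.C₁) =
      ((λ_ I.C₁).inv ≫ I.bot ▷ I.C₁) ≫ (ρ_ _).inv ≫
        (I.C₁ ⊗ I.C₁) ◁ I.top ≫ (α_ I.C₁ I.C₁ I.C₁).hom := by
    have e : I.bot ▷ I.C₁ ≫ (ρ_ _).inv = (ρ_ _).inv ≫ (I.bot ▷ I.C₁) ▷ 𝟙_ E := by simp
    rw [Category.assoc, Category.assoc, reassoc_of% e, ← whisker_exchange_assoc]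
    monoidal
  conv_lhs => rw [comul_comp, concat_congr ex hz]
  conv_rhs => rw [comul_comp, concat_congr hx ey]
  rw [concat_congr (concat_congr rfl hy _) rfl, concat_assoc]

end Comonoid

/-! ### Squares of homotopies in a representable interval -/

section Whiskering

variable {E : Type u} [Category.{v} E] [MonoidalCategory E] {I : StrictInterval E}

theorem refl_hcomp_map {A B C : E} (f : A ⟶ B) {h k : B ⟶ C} (γ : I.Homotopy h k) :
    ((Homotopy.refl f).hcomp γ).map = f ▷ I.C₁ ≫ γ.map := by
  have h₁ : A ◁ (λ_ I.C₁).inv ≫ (α_ A (𝟙_ E) I.C₁).inv ≫ (ρ_ A).hom ▷ I.C₁ = 𝟙 _ := by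
    monoidal
  simp only [Homotopy.hcomp, Homotopy.refl, comp_whiskerRight, Category.assoc]
  rw [← associator_inv_naturality_middle_assoc, ← whiskerLeft_comp_assoc, comul_counit_left,
    reassoc_of% h₁]

theorem hcomp_refl_map {A B C : E} {f g : A ⟶ B} (η : I.Homotopy f g) (h : B ⟶ C) :
    (η.hcomp (Homotopy.refl h)).map = η.map ≫ h := by
  have h₁ : A ◁ (ρ_ I.C₁).inv ≫ (α_ A I.C₁ (𝟙_ E)).inv ≫ (ρ_ (A ⊗ I.C₁)).hom = 𝟙 _ := by
    monoidal
  simp only [Homotopy.hcomp, Homotopy.refl]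
  rw [← whisker_exchange_assoc, ← associator_inv_naturality_right_assoc,
    ← whiskerLeft_comp_assoc, comul_counit_right, rightUnitor_naturality_assoc, reassoc_of% h₁]

end Whiskering

section Cotensor

variable {E : Type u} [Category.{v} E] [MonoidalCategory E] [MonoidalClosed E]
  {I : StrictInterval E}

theorem HomCat.hom_ext {A B : E} {f g : I.HomCat A B} {φ ψ : f ⟶ g}
    (h : φ.map = ψ.map) : φ = ψ :=
  Homotopy.ext h

/-- An object of `E(A, B)^𝟐` is determined by the map underlying it. -/
theorem arrow_ext {A B : E} {X Y : Arrow (I.HomCat A B)} (h : X.hom.map = Y.hom.map) : X = Y := by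
  obtain ⟨⟨f⟩, ⟨g⟩, φ⟩ := X
  obtain ⟨⟨f'⟩, ⟨g'⟩, ψ⟩ := Y
  change φ.map = ψ.map at h
  obtain rfl : f = f' := by
    rw [← cancel_epi (ρ_ A).hom]
    exact φ.dom.symm.trans ((congrArg _ h).trans ψ.dom)
  obtain rfl : g = g' := by
    rw [← cancel_epi (ρ_ A).hom]
    exact φ.cod.symm.trans ((congrArg _ h).trans ψ.cod)
  obtain rfl : φ = ψ := HomCat.hom_ext h
  rfl

namespace Cotensor

variable {A P : E} (C : I.Cotensor A P)

/-- The universal homotopy `P ⊗ I ⟶ A` of a cotensor. -/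
noncomputable def ev : P ⊗ I.C₁ ⟶ A := ((C.toArrow P).obj ⟨𝟙 P⟩).hom.map

theorem toArrow_obj_hom_map {B : E} (f : I.HomCat B P) :
    ((C.toArrow B).obj f).hom.map = f.map ▷ I.C₁ ≫ C.ev := by
  have h : ((C.toArrow B).obj ⟨f.map ≫ 𝟙 P⟩).hom.map = f.map ▷ I.C₁ ≫ C.ev :=
    (C.naturality_obj f.map ⟨𝟙 P⟩).trans (refl_hcomp_map _ _)
  rw [Category.comp_id] at h
  exact h

theorem toArrow_obj_left_map {B : E} (f : I.HomCat B P) :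
    ((C.toArrow B).obj f).left.map = f.map ≫ (ρ_ P).inv ≫ P ◁ I.bot ≫ C.ev := by
  rw [← cancel_epi (ρ_ B).hom, ← ((C.toArrow B).obj f).hom.dom, toArrow_obj_hom_map,
    whisker_exchange_assoc]
  simp

theorem toArrow_obj_right_map {B : E} (f : I.HomCat B P) :
    ((C.toArrow B).obj f).right.map = f.map ≫ (ρ_ P).inv ≫ P ◁ I.top ≫ C.ev := by
  rw [← cancel_epi (ρ_ B).hom, ← ((C.toArrow B).obj f).hom.cod, toArrow_obj_hom_map,
    whisker_exchange_assoc]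
  simp

/-- The square classified by a homotopy `θ` into the cotensor has as its first component the
restriction along `⊥`. This is naturality with respect to `θ * 1`, for the identity
2-cell of `P`. -/
theorem toArrow_map_left_map {B : E} {f g : I.HomCat B P} (θ : f ⟶ g) :
    ((C.toArrow B).map θ).left.map = θ.map ≫ (ρ_ P).inv ≫ P ◁ I.bot ≫ C.ev := by
  have h := C.naturality_left (B := P) (u := f.map) (u' := g.map) θ (𝟙 ⟨𝟙 P⟩)
  rw [CategoryTheory.Functor.map_id] at h
  have h' := h.trans (hcomp_refl_map _ _)
  refine Eq.trans ?_ (h'.trans (by rw [toArrow_obj_left_map, Category.id_comp]))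
  -- `θ` and `θ * 1` have the same underlying map, but their sources `f` and `f ≫ 𝟙 P` (and likewise
  -- their targets) agree only propositionally.
  have key : ∀ {f' g' : I.HomCat B P} (θ' : f' ⟶ g'), f = f' → g = g' → θ.map = θ'.map →
      ((C.toArrow B).map θ).left.map = ((C.toArrow B).map θ').left.map := by
    rintro _ _ θ' rfl rfl h
    rw [HomCat.hom_ext h]
  exact key _ (by simp) (by simp) ((hcomp_refl_map θ (𝟙 P)).trans (Category.comp_id _)).symm

/-- The square classified by a homotopy `θ` into the cotensor has as its second component the
restriction along `⊤`. -/
theorem toArrow_map_right_map {B : E} {f g : I.HomCat B P} (θ : f ⟶ g) :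
    ((C.toArrow B).map θ).right.map = θ.map ≫ (ρ_ P).inv ≫ P ◁ I.top ≫ C.ev := by
  have h := C.naturality_right (B := P) (u := f.map) (u' := g.map) θ (𝟙 ⟨𝟙 P⟩)
  rw [CategoryTheory.Functor.map_id] at h
  have h' := h.trans (hcomp_refl_map _ _)
  refine Eq.trans ?_ (h'.trans (by rw [toArrow_obj_right_map, Category.id_comp]))
  have key : ∀ {f' g' : I.HomCat B P} (θ' : f' ⟶ g'), f = f' → g = g' → θ.map = θ'.map →
      ((C.toArrow B).map θ).right.map = ((C.toArrow B).map θ').right.map := by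
    rintro _ _ θ' rfl rfl h
    rw [HomCat.hom_ext h]
  exact key _ (by simp) (by simp) ((hcomp_refl_map θ (𝟙 P)).trans (Category.comp_id _)).symm

theorem toArrow_obj_injective {B : E} {f g : I.HomCat B P}
    (h : (C.toArrow B).obj f = (C.toArrow B).obj g) : f = g := by
  have hf := Functor.congr_obj (C.toArrow_ofArrow B) f
  rw [Functor.comp_obj, h] at hf
  exact hf.symm.trans (Functor.congr_obj (C.toArrow_ofArrow B) g)

theorem hom_ext {B : E} {f g : B ⟶ P} (h : f ▷ I.C₁ ≫ C.ev = g ▷ I.C₁ ≫ C.ev) : f = g := by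
  have : (⟨f⟩ : I.HomCat B P) = ⟨g⟩ := C.toArrow_obj_injective <| arrow_ext <| by
    rw [toArrow_obj_hom_map, toArrow_obj_hom_map, h]
  exact congrArg HomCat.map this

/-- Every map `B ⊗ I ⟶ A` is a homotopy, so that it is classified by a map `B ⟶ P`. -/
theorem exists_whiskerRight_ev {B : E} (k : B ⊗ I.C₁ ⟶ A) :
    ∃ f : B ⟶ P, f ▷ I.C₁ ≫ C.ev = k := by
  let X : Arrow (I.HomCat B A) :=
    Arrow.mk (X := ⟨(ρ_ B).inv ≫ B ◁ I.bot ≫ k⟩) (Y := ⟨(ρ_ B).inv ≫ B ◁ I.top ≫ k⟩)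
      (Homotopy.mk k (by simp) (by simp))
  refine ⟨((C.ofArrow B).obj X).map, ?_⟩
  rw [← toArrow_obj_hom_map]
  have h : (C.toArrow B).obj ((C.ofArrow B).obj X) = X :=
    Functor.congr_obj (C.ofArrow_toArrow B) X
  rw [h]
  rfl

theorem toArrow_map_injective {B : E} {f g : I.HomCat B P} {θ θ' : f ⟶ g}
    (h : (C.toArrow B).map θ = (C.toArrow B).map θ') : θ = θ' := by
  have h₁ := Functor.congr_hom (C.toArrow_ofArrow B) θ
  have h₂ := Functor.congr_hom (C.toArrow_ofArrow B) θ'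
  rw [Functor.comp_map, h, ← Functor.comp_map, h₂] at h₁
  rw [cancel_epi, cancel_mono] at h₁
  exact h₁.symm

/-- If a cotensor of `A` with `𝟐` exists, a map `(B ⊗ I) ⊗ I ⟶ A` is determined by its restrictions
to the four sides of the square. The first two restrictions determine the source and target of the
homotopy `B ⊗ I ⟶ P` that corresponds to the map, the other two the square that it classifies. -/
theorem square_ext (C : I.Cotensor A P) {B : E} {h h' : (B ⊗ I.C₁) ⊗ I.C₁ ⟶ A}
    (h₁ : (B ◁ I.bot) ▷ I.C₁ ≫ h = (B ◁ I.bot) ▷ I.C₁ ≫ h')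
    (h₂ : (B ◁ I.top) ▷ I.C₁ ≫ h = (B ◁ I.top) ▷ I.C₁ ≫ h')
    (h₃ : (B ⊗ I.C₁) ◁ I.bot ≫ h = (B ⊗ I.C₁) ◁ I.bot ≫ h')
    (h₄ : (B ⊗ I.C₁) ◁ I.top ≫ h = (B ⊗ I.C₁) ◁ I.top ≫ h') : h = h' := by
  obtain ⟨θ, rfl⟩ := C.exists_whiskerRight_ev h
  obtain ⟨θ', rfl⟩ := C.exists_whiskerRight_ev h'
  have e₁ : B ◁ I.bot ≫ θ = B ◁ I.bot ≫ θ' := C.hom_ext (by simpa using h₁)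
  have e₂ : B ◁ I.top ≫ θ = B ◁ I.top ≫ θ' := C.hom_ext (by simpa using h₂)
  let f : I.HomCat B P := ⟨(ρ_ B).inv ≫ B ◁ I.bot ≫ θ⟩
  let g : I.HomCat B P := ⟨(ρ_ B).inv ≫ B ◁ I.top ≫ θ⟩
  let t : f ⟶ g := Homotopy.mk θ (by simp [f]) (by simp [g])
  let t' : f ⟶ g := Homotopy.mk θ' (by simp [f, e₁]) (by simp [g, e₂])
  rw [whisker_exchange_assoc, whisker_exchange_assoc] at h₃ h₄
  have : t = t' := by
    apply C.toArrow_map_injective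
    refine Arrow.hom_ext _ _ (HomCat.hom_ext ?_) (HomCat.hom_ext ?_)
    · rw [toArrow_map_left_map, toArrow_map_left_map, ← cancel_epi (ρ_ _).hom]
      simpa [t, t'] using h₃
    · rw [toArrow_map_right_map, toArrow_map_right_map, ← cancel_epi (ρ_ _).hom]
      simpa [t, t'] using h₄
  rw [show θ = θ' from congrArg Homotopy.map this]

/-- Every commutative square of homotopies is the boundary of a map `(B ⊗ I) ⊗ I ⟶ A`. -/
theorem exists_square (C : I.Cotensor A P) {B : E} {p q r s : I.HomCat B A}
    (a : p ⟶ q) (b : r ⟶ s) (l : p ⟶ r) (t : q ⟶ s) (w : l ≫ b = a ≫ t) :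
    ∃ h : (B ⊗ I.C₁) ⊗ I.C₁ ⟶ A,
      (B ◁ I.bot) ▷ I.C₁ ≫ h = (ρ_ B).hom ▷ I.C₁ ≫ a.map ∧
      (B ◁ I.top) ▷ I.C₁ ≫ h = (ρ_ B).hom ▷ I.C₁ ≫ b.map ∧
      (B ⊗ I.C₁) ◁ I.bot ≫ h = (ρ_ _).hom ≫ l.map ∧
      (B ⊗ I.C₁) ◁ I.top ≫ h = (ρ_ _).hom ≫ t.map := by
  let φ : Arrow.mk a ⟶ Arrow.mk b := Arrow.homMk l t w
  let θ := (C.ofArrow B).map φ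
  have hobj (X) : (C.toArrow B).obj ((C.ofArrow B).obj X) = X :=
    Functor.congr_obj (C.ofArrow_toArrow B) X
  have hθ := Functor.congr_hom (C.ofArrow_toArrow B) φ
  -- `ofArrow` is inverse to `toArrow` only up to `eqToHom`, which does not affect underlying maps.
  have key : ∀ {X Y X' Y' : Arrow (I.HomCat B A)} (hX : X' = X) (hY : Y = Y') (f : X ⟶ Y),
      (eqToHom hX ≫ f ≫ eqToHom hY).left.map = f.left.map ∧
      (eqToHom hX ≫ f ≫ eqToHom hY).right.map = f.right.map := by
    rintro _ _ _ _ rfl rfl f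
    simp
  have hl : θ.map ≫ (ρ_ P).inv ≫ P ◁ I.bot ≫ C.ev = l.map := by
    rw [← toArrow_map_left_map]
    exact (congrArg (fun x => x.left.map) hθ).trans (key _ _ φ).1
  have hr : θ.map ≫ (ρ_ P).inv ≫ P ◁ I.top ≫ C.ev = t.map := by
    rw [← toArrow_map_right_map]
    exact (congrArg (fun x => x.right.map) hθ).trans (key _ _ φ).2
  have ha : ((C.ofArrow B).obj (Arrow.mk a)).map ▷ I.C₁ ≫ C.ev = a.map := by
    rw [← toArrow_obj_hom_map, hobj]
    rfl
  have hb : ((C.ofArrow B).obj (Arrow.mk b)).map ▷ I.C₁ ≫ C.ev = b.map := by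
    rw [← toArrow_obj_hom_map, hobj]
    rfl
  refine ⟨θ.map ▷ I.C₁ ≫ C.ev, ?_, ?_, ?_, ?_⟩
  · rw [← comp_whiskerRight_assoc, θ.dom, comp_whiskerRight_assoc, ha]
  · rw [← comp_whiskerRight_assoc, θ.cod, comp_whiskerRight_assoc, hb]
  · rw [whisker_exchange_assoc, ← hl]; simp
  · rw [whisker_exchange_assoc, ← hr]; simp

end Cotensor

end Cotensor

/-! ### Meet and join as fillers of squares -/

section Connection

variable {E : Type u} [Category.{v} E] [MonoidalCategory E] (I : StrictInterval E)

/-- A binary operation on an interval for which the point `e` is neutral and the point `z` is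
absorbing. For `z, e = ⊥, ⊤` this is a meet, for `z, e = ⊤, ⊥` a join. -/
structure IsConnection (z e : 𝟙_ E ⟶ I.C₁) (m : I.C₁ ⊗ I.C₁ ⟶ I.C₁) : Prop where
  zero_left : z ▷ I.C₁ ≫ m = (λ_ I.C₁).hom ≫ I.coid ≫ z
  one_left : e ▷ I.C₁ ≫ m = (λ_ I.C₁).hom
  zero_right : I.C₁ ◁ z ≫ m = (ρ_ I.C₁).hom ≫ I.coid ≫ z
  one_right : I.C₁ ◁ e ≫ m = (ρ_ I.C₁).hom

/-- `z` and `e` are the two endpoints of the interval, in either order. -/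
def IsEndpoints (z e : 𝟙_ E ⟶ I.C₁) : Prop :=
  (z = I.bot ∧ e = I.top) ∨ (z = I.top ∧ e = I.bot)

end Connection

section Lattice

variable {E : Type u} [Category.{v} E] [MonoidalCategory E] [MonoidalClosed E]
  {I : StrictInterval E}

theorem IsRepresentable.square_ext (hI : I.IsRepresentable) {A B : E}
    {h h' : (B ⊗ I.C₁) ⊗ I.C₁ ⟶ A}
    (h₁ : (B ◁ I.bot) ▷ I.C₁ ≫ h = (B ◁ I.bot) ▷ I.C₁ ≫ h')
    (h₂ : (B ◁ I.top) ▷ I.C₁ ≫ h = (B ◁ I.top) ▷ I.C₁ ≫ h')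
    (h₃ : (B ⊗ I.C₁) ◁ I.bot ≫ h = (B ⊗ I.C₁) ◁ I.bot ≫ h')
    (h₄ : (B ⊗ I.C₁) ◁ I.top ≫ h = (B ⊗ I.C₁) ◁ I.top ≫ h') : h = h' := by
  obtain ⟨P, ⟨C⟩⟩ := hI A
  exact C.square_ext h₁ h₂ h₃ h₄

/-- The case `B = 𝟙_ E` of `IsRepresentable.square_ext`. -/
theorem IsRepresentable.hom_ext (hI : I.IsRepresentable) {A : E} {h h' : I.C₁ ⊗ I.C₁ ⟶ A}
    (h₁ : I.bot ▷ I.C₁ ≫ h = I.bot ▷ I.C₁ ≫ h')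
    (h₂ : I.top ▷ I.C₁ ≫ h = I.top ▷ I.C₁ ≫ h')
    (h₃ : I.C₁ ◁ I.bot ≫ h = I.C₁ ◁ I.bot ≫ h')
    (h₄ : I.C₁ ◁ I.top ≫ h = I.C₁ ◁ I.top ≫ h') : h = h' := by
  rw [← cancel_epi ((λ_ I.C₁).hom ▷ I.C₁)]
  apply hI.square_ext
  · simp [h₁]
  · simp [h₂]
  · rw [whisker_exchange_assoc, whisker_exchange_assoc, h₃]
  · rw [whisker_exchange_assoc, whisker_exchange_assoc, h₄]

/-- The meet fills the square with sides `1 : ⊥ ⇒ ⊥` and `u : ⊥ ⇒ ⊤`, the latter being given by the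
identity of `I`. -/
theorem IsRepresentable.exists_meet (hI : I.IsRepresentable) :
    ∃ m, I.IsConnection I.bot I.top m := by
  obtain ⟨P, ⟨C⟩⟩ := hI I.C₁
  let p : I.HomCat (𝟙_ E) I.C₁ := ⟨I.bot⟩
  let q : I.HomCat (𝟙_ E) I.C₁ := ⟨I.top⟩
  let e : p ⟶ q := Homotopy.mk (λ_ I.C₁).hom
    (by rw [leftUnitor_naturality, unitors_equal]) (by rw [leftUnitor_naturality, unitors_equal])
  obtain ⟨h, h₁, h₂, h₃, h₄⟩ := C.exists_square (𝟙 p) e (𝟙 p) e rfl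
  have hp : (𝟙 p : p ⟶ p).map = (λ_ I.C₁).hom ≫ I.coid ≫ I.bot := by
    change 𝟙_ E ◁ I.coid ≫ (ρ_ _).hom ≫ I.bot = _
    rw [← unitors_equal, leftUnitor_naturality_assoc]
  rw [hp] at h₁ h₃
  refine ⟨(λ_ I.C₁).inv ▷ I.C₁ ≫ h, ?_, ?_, ?_, ?_⟩
  · rw [← comp_whiskerRight_assoc, leftUnitor_inv_naturality, comp_whiskerRight_assoc, h₁]
    simp
  · rw [← comp_whiskerRight_assoc, leftUnitor_inv_naturality, comp_whiskerRight_assoc, h₂]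
    simp [e]
  · rw [whisker_exchange_assoc, h₃]
    simp
  · rw [whisker_exchange_assoc, h₄]
    simp [e]

/-- The join fills the square with sides `u : ⊥ ⇒ ⊤` and `1 : ⊤ ⇒ ⊤`. -/
theorem IsRepresentable.exists_join (hI : I.IsRepresentable) :
    ∃ m, I.IsConnection I.top I.bot m := by
  obtain ⟨P, ⟨C⟩⟩ := hI I.C₁
  let p : I.HomCat (𝟙_ E) I.C₁ := ⟨I.bot⟩
  let q : I.HomCat (𝟙_ E) I.C₁ := ⟨I.top⟩
  let e : p ⟶ q := Homotopy.mk (λ_ I.C₁).hom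
    (by rw [leftUnitor_naturality, unitors_equal]) (by rw [leftUnitor_naturality, unitors_equal])
  obtain ⟨h, h₁, h₂, h₃, h₄⟩ := C.exists_square e (𝟙 q) e (𝟙 q) rfl
  have hq : (𝟙 q : q ⟶ q).map = (λ_ I.C₁).hom ≫ I.coid ≫ I.top := by
    change 𝟙_ E ◁ I.coid ≫ (ρ_ _).hom ≫ I.top = _
    rw [← unitors_equal, leftUnitor_naturality_assoc]
  rw [hq] at h₂ h₄
  refine ⟨(λ_ I.C₁).inv ▷ I.C₁ ≫ h, ?_, ?_, ?_, ?_⟩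
  · rw [← comp_whiskerRight_assoc, leftUnitor_inv_naturality, comp_whiskerRight_assoc, h₂]
    simp
  · rw [← comp_whiskerRight_assoc, leftUnitor_inv_naturality, comp_whiskerRight_assoc, h₁]
    simp [e]
  · rw [whisker_exchange_assoc, h₄]
    simp
  · rw [whisker_exchange_assoc, h₃]
    simp [e]

end Lattice

/-! ### The Hopf object structure -/

namespace IsEndpoints

variable {E : Type u} [Category.{v} E] [MonoidalCategory E]
  {I : StrictInterval E} {z e : 𝟙_ E ⟶ I.C₁}

theorem coid_left (hze : I.IsEndpoints z e) : z ≫ I.coid = 𝟙 _ := by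
  obtain ⟨rfl, rfl⟩ | ⟨rfl, rfl⟩ := hze
  exacts [I.bot_coid, I.top_coid]

theorem comul_left (hze : I.IsEndpoints z e) : z ≫ I.comul = (λ_ _).inv ≫ (z ⊗ₘ z) := by
  obtain ⟨rfl, rfl⟩ | ⟨rfl, rfl⟩ := hze
  · rw [bot_comul, leftUnitor_inv_naturality_assoc, tensorHom_def']
  · rw [top_comul, rightUnitor_inv_naturality_assoc, MonoidalCategory.tensorHom_def,
      unitors_inv_equal]

theorem symm (hze : I.IsEndpoints z e) : I.IsEndpoints e z :=
  hze.elim (fun h => .inr ⟨h.2, h.1⟩) (fun h => .inl ⟨h.2, h.1⟩)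

theorem hom_ext [MonoidalClosed E] (hze : I.IsEndpoints z e) (hI : I.IsRepresentable) {A : E}
    {h h' : I.C₁ ⊗ I.C₁ ⟶ A}
    (h₁ : z ▷ I.C₁ ≫ h = z ▷ I.C₁ ≫ h') (h₂ : e ▷ I.C₁ ≫ h = e ▷ I.C₁ ≫ h')
    (h₃ : I.C₁ ◁ z ≫ h = I.C₁ ◁ z ≫ h') (h₄ : I.C₁ ◁ e ≫ h = I.C₁ ◁ e ≫ h') : h = h' := by
  obtain ⟨rfl, rfl⟩ | ⟨rfl, rfl⟩ := hze
  exacts [hI.hom_ext h₁ h₂ h₃ h₄, hI.hom_ext h₂ h₁ h₄ h₃]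

theorem square_ext [MonoidalClosed E] (hze : I.IsEndpoints z e) (hI : I.IsRepresentable)
    {A B : E} {h h' : (B ⊗ I.C₁) ⊗ I.C₁ ⟶ A}
    (h₁ : (B ◁ z) ▷ I.C₁ ≫ h = (B ◁ z) ▷ I.C₁ ≫ h')
    (h₂ : (B ◁ e) ▷ I.C₁ ≫ h = (B ◁ e) ▷ I.C₁ ≫ h')
    (h₃ : (B ⊗ I.C₁) ◁ z ≫ h = (B ⊗ I.C₁) ◁ z ≫ h')
    (h₄ : (B ⊗ I.C₁) ◁ e ≫ h = (B ⊗ I.C₁) ◁ e ≫ h') : h = h' := by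
  obtain ⟨rfl, rfl⟩ | ⟨rfl, rfl⟩ := hze
  exacts [hI.square_ext h₁ h₂ h₃ h₄, hI.square_ext h₂ h₁ h₄ h₃]

end IsEndpoints

section Points

variable {E : Type u} [Category.{v} E] [MonoidalCategory E] {I : StrictInterval E}

theorem comul_coid_tensor_coid : I.comul ≫ (I.coid ⊗ₘ I.coid) = I.coid ≫ (λ_ (𝟙_ E)).inv := by
  rw [MonoidalCategory.tensorHom_def, reassoc_of% comul_counit_left I, leftUnitor_inv_naturality]

/-- The constant map at an endpoint is compatible with `Δ`. -/
theorem coid_comp_comul {z e : 𝟙_ E ⟶ I.C₁} (hze : I.IsEndpoints z e) :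
    (I.coid ≫ z) ≫ I.comul = I.comul ≫ ((I.coid ≫ z) ⊗ₘ (I.coid ≫ z)) := by
  rw [← tensorHom_comp_tensorHom, reassoc_of% comul_coid_tensor_coid (I := I), Category.assoc,
    hze.comul_left]

theorem whiskerRight_tensor_coid {x : 𝟙_ E ⟶ I.C₁} (hx : x ≫ I.coid = 𝟙 _) :
    x ▷ I.C₁ ≫ (I.coid ⊗ₘ I.coid) ≫ (λ_ _).hom = (λ_ _).hom ≫ I.coid := by
  rw [MonoidalCategory.tensorHom_def, Category.assoc, ← comp_whiskerRight_assoc, hx]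
  simp

theorem whiskerLeft_tensor_coid {x : 𝟙_ E ⟶ I.C₁} (hx : x ≫ I.coid = 𝟙 _) :
    I.C₁ ◁ x ≫ (I.coid ⊗ₘ I.coid) ≫ (λ_ _).hom = (ρ_ _).hom ≫ I.coid := by
  rw [tensorHom_def', Category.assoc, ← whiskerLeft_comp_assoc, hx]
  simp [unitors_equal]

variable [SymmetricCategory E]

/-- If the point `x` is grouplike and multiplication by `x` on the left is `g`, then left
multiplication by `Δ x` on `I ⊗ I` is `g ⊗ g`. -/
theorem whiskerRight_tensorμ {x : 𝟙_ E ⟶ I.C₁} {m : I.C₁ ⊗ I.C₁ ⟶ I.C₁} {g : I.C₁ ⟶ I.C₁}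
    (hx : x ≫ I.comul = (λ_ _).inv ≫ (x ⊗ₘ x)) (hg : x ▷ I.C₁ ≫ m = (λ_ _).hom ≫ g) :
    x ▷ I.C₁ ≫ (I.comul ⊗ₘ I.comul) ≫ tensorμ _ _ _ _ ≫ (m ⊗ₘ m) =
      (λ_ _).hom ≫ I.comul ≫ (g ⊗ₘ g) := by
  have h₁ : x ▷ I.C₁ ≫ (I.comul ⊗ₘ I.comul) =
      𝟙_ E ◁ I.comul ≫ (λ_ _).inv ▷ _ ≫ ((x ⊗ₘ x) ⊗ₘ (𝟙 I.C₁ ⊗ₘ 𝟙 I.C₁)) := by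
    simp only [← tensorHom_id, ← id_tensorHom, tensorHom_comp_tensorHom, Category.id_comp,
      Category.comp_id, hx, id_tensorHom_id]
  rw [reassoc_of% h₁, tensorμ_natural_assoc, tensorHom_comp_tensorHom, tensorHom_id, hg,
    ← tensorHom_comp_tensorHom, ← leftUnitor_naturality_assoc, tensor_left_unitality]
  simp only [Category.assoc]

theorem whiskerLeft_tensorμ {x : 𝟙_ E ⟶ I.C₁} {m : I.C₁ ⊗ I.C₁ ⟶ I.C₁} {g : I.C₁ ⟶ I.C₁}
    (hx : x ≫ I.comul = (λ_ _).inv ≫ (x ⊗ₘ x)) (hg : I.C₁ ◁ x ≫ m = (ρ_ _).hom ≫ g) :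
    I.C₁ ◁ x ≫ (I.comul ⊗ₘ I.comul) ≫ tensorμ _ _ _ _ ≫ (m ⊗ₘ m) =
      (ρ_ _).hom ≫ I.comul ≫ (g ⊗ₘ g) := by
  have h₁ : I.C₁ ◁ x ≫ (I.comul ⊗ₘ I.comul) =
      I.comul ▷ 𝟙_ E ≫ _ ◁ (λ_ _).inv ≫ ((𝟙 I.C₁ ⊗ₘ 𝟙 I.C₁) ⊗ₘ (x ⊗ₘ x)) := by
    simp only [← tensorHom_id, ← id_tensorHom, tensorHom_comp_tensorHom, Category.id_comp,
      Category.comp_id, hx, id_tensorHom_id]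
  rw [reassoc_of% h₁, tensorμ_natural_assoc, tensorHom_comp_tensorHom, id_tensorHom, hg,
    ← tensorHom_comp_tensorHom, ← rightUnitor_naturality_assoc, tensor_right_unitality]
  simp only [Category.assoc]

end Points

namespace IsConnection

section

variable {E : Type u} [Category.{v} E] [MonoidalCategory E]
  {I : StrictInterval E} {z e : 𝟙_ E ⟶ I.C₁} {m : I.C₁ ⊗ I.C₁ ⟶ I.C₁}

theorem whiskerLeft_zero (hm : I.IsConnection z e m) :
    I.C₁ ◁ (I.coid ≫ z) ≫ m = (I.coid ⊗ₘ I.coid) ≫ (λ_ _).hom ≫ z := by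
  rw [whiskerLeft_comp_assoc, hm.zero_right, tensorHom_def', Category.assoc, unitors_equal,
    rightUnitor_naturality_assoc]

theorem whiskerRight_zero (hm : I.IsConnection z e m) :
    (I.coid ≫ z) ▷ I.C₁ ≫ m = (I.coid ⊗ₘ I.coid) ≫ (λ_ _).hom ≫ z := by
  rw [comp_whiskerRight_assoc, hm.zero_left, MonoidalCategory.tensorHom_def, Category.assoc,
    leftUnitor_naturality_assoc]

variable [SymmetricCategory E]

theorem braiding (hm : I.IsConnection z e m) : I.IsConnection z e ((β_ I.C₁ I.C₁).hom ≫ m) where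
  zero_left := by
    rw [BraidedCategory.braiding_naturality_left_assoc, hm.zero_right, braiding_rightUnitor_assoc]
  one_left := by
    rw [BraidedCategory.braiding_naturality_left_assoc, hm.one_right, braiding_rightUnitor]
  zero_right := by
    rw [BraidedCategory.braiding_naturality_right_assoc, hm.zero_left, braiding_leftUnitor_assoc]
  one_right := by
    rw [BraidedCategory.braiding_naturality_right_assoc, hm.one_left, braiding_leftUnitor]

end

variable {E : Type u} [Category.{v} E] [MonoidalCategory E] [MonoidalClosed E]
  {I : StrictInterval E} {z e : 𝟙_ E ⟶ I.C₁} {m : I.C₁ ⊗ I.C₁ ⟶ I.C₁}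

theorem unique (hI : I.IsRepresentable) (hze : I.IsEndpoints z e) (hm : I.IsConnection z e m)
    {m' : I.C₁ ⊗ I.C₁ ⟶ I.C₁} (hm' : I.IsConnection z e m') : m = m' :=
  hze.hom_ext hI (by rw [hm.zero_left, hm'.zero_left]) (by rw [hm.one_left, hm'.one_left])
    (by rw [hm.zero_right, hm'.zero_right]) (by rw [hm.one_right, hm'.one_right])

theorem comp_coid (hI : I.IsRepresentable) (hze : I.IsEndpoints z e) (hm : I.IsConnection z e m) :
    m ≫ I.coid = (I.coid ⊗ₘ I.coid) ≫ (λ_ _).hom := by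
  apply hze.hom_ext hI
  · rw [whiskerRight_tensor_coid hze.coid_left, reassoc_of% hm.zero_left, hze.coid_left,
      Category.comp_id]
  · rw [whiskerRight_tensor_coid hze.symm.coid_left, reassoc_of% hm.one_left]
  · rw [whiskerLeft_tensor_coid hze.coid_left, reassoc_of% hm.zero_right, hze.coid_left,
      Category.comp_id]
  · rw [whiskerLeft_tensor_coid hze.symm.coid_left, reassoc_of% hm.one_right]

theorem assoc (hI : I.IsRepresentable) (hze : I.IsEndpoints z e) (hm : I.IsConnection z e m) :
    m ▷ I.C₁ ≫ m = (α_ _ _ _).hom ≫ I.C₁ ◁ m ≫ m := by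
  -- Restriction to an endpoint in the middle argument.
  have middle {x : 𝟙_ E ⟶ I.C₁} {g : I.C₁ ⟶ I.C₁} (hl : x ▷ I.C₁ ≫ m = (λ_ _).hom ≫ g)
      (hr : I.C₁ ◁ x ≫ m = (ρ_ _).hom ≫ g) (hg : g ▷ I.C₁ ≫ m = I.C₁ ◁ g ≫ m) :
      (I.C₁ ◁ x) ▷ I.C₁ ≫ m ▷ I.C₁ ≫ m =
        (I.C₁ ◁ x) ▷ I.C₁ ≫ (α_ _ _ _).hom ≫ I.C₁ ◁ m ≫ m := by
    rw [← comp_whiskerRight_assoc, hr, associator_naturality_middle_assoc,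
      ← whiskerLeft_comp_assoc, hl]
    simp [hg]
  -- Restriction to an endpoint in the last argument.
  have right {x : 𝟙_ E ⟶ I.C₁} {g : I.C₁ ⟶ I.C₁} (hr : I.C₁ ◁ x ≫ m = (ρ_ _).hom ≫ g)
      (hg : m ≫ g = I.C₁ ◁ g ≫ m) :
      (I.C₁ ⊗ I.C₁) ◁ x ≫ m ▷ I.C₁ ≫ m =
        (I.C₁ ⊗ I.C₁) ◁ x ≫ (α_ _ _ _).hom ≫ I.C₁ ◁ m ≫ m := by
    rw [whisker_exchange_assoc, hr, associator_naturality_right_assoc, ← whiskerLeft_comp_assoc,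
      hr, rightUnitor_naturality_assoc, hg]
    simp
  refine hze.square_ext hI ?_ ?_ ?_ ?_
  · exact middle hm.zero_left hm.zero_right (by rw [hm.whiskerLeft_zero, hm.whiskerRight_zero])
  · exact middle (g := 𝟙 _) (by simpa using hm.one_left) (by simpa using hm.one_right) (by simp)
  · exact right hm.zero_right
      (by rw [hm.whiskerLeft_zero, reassoc_of% comp_coid hI hze hm])
  · exact right (g := 𝟙 _) (by simpa using hm.one_right) (by simp)

variable [SymmetricCategory E]

theorem comp_comul (hI : I.IsRepresentable) (hze : I.IsEndpoints z e) (hm : I.IsConnection z e m) :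
    m ≫ I.comul = (I.comul ⊗ₘ I.comul) ≫ tensorμ _ _ _ _ ≫ (m ⊗ₘ m) := by
  apply hze.hom_ext hI
  · rw [whiskerRight_tensorμ hze.comul_left hm.zero_left, reassoc_of% hm.zero_left,
      ← coid_comp_comul hze, Category.assoc]
  · rw [whiskerRight_tensorμ (g := 𝟙 _) hze.symm.comul_left (by simpa using hm.one_left),
      reassoc_of% hm.one_left]
    simp
  · rw [whiskerLeft_tensorμ hze.comul_left hm.zero_right, reassoc_of% hm.zero_right,
      ← coid_comp_comul hze, Category.assoc]
  · rw [whiskerLeft_tensorμ (g := 𝟙 _) hze.symm.comul_left (by simpa using hm.one_right),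
      reassoc_of% hm.one_right]
    simp

theorem isCommHopfObject (hI : I.IsRepresentable) (hze : I.IsEndpoints z e)
    (hm : I.IsConnection z e m) : IsCommHopfObject I.C₁ e m I.coid I.comul := by
  let M : MonObj I.C₁ :=
    { one := e
      mul := m
      one_mul := hm.one_left
      mul_one := hm.one_right
      mul_assoc := hm.assoc hI hze }
  let K : ComonObj I.C₁ :=
    { counit := I.coid
      comul := I.comul
      counit_comul := comul_counit_left I
      comul_counit := comul_counit_right I
      comul_assoc := comul_coassoc I }
  let H : BimonObj I.C₁ :=
    { M, K with
      mul_comul := hm.comp_comul hI hze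
      one_comul := hze.symm.comul_left
      mul_counit := hm.comp_coid hI hze
      one_counit := hze.symm.coid_left }
  exact ⟨H, ⟨unique hI hze hm.braiding hm⟩, rfl, rfl, rfl, rfl⟩

end IsConnection

section Lattice

variable {E : Type u} [Category.{v} E] [MonoidalCategory E] [SymmetricCategory E]
  {I : StrictInterval E}

theorem isMeet_iff {m : I.C₁ ⊗ I.C₁ ⟶ I.C₁} : I.IsMeet m ↔ I.IsConnection I.bot I.top m := by
  constructor
  · rintro ⟨⟨η, rfl⟩, θ, hθ⟩
    have h₁ := θ.dom
    have h₂ := θ.cod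
    rw [hθ, BraidedCategory.braiding_naturality_right_assoc, ← braiding_leftUnitor_assoc,
      cancel_epi] at h₁ h₂
    exact ⟨h₁, by simpa using h₂, η.dom, by simpa using η.cod⟩
  · intro h
    have h' := h.braiding
    exact ⟨⟨⟨_, h.zero_right, by simpa using h.one_right⟩, rfl⟩,
      ⟨_, h'.zero_right, by simpa using h'.one_right⟩, rfl⟩

theorem isJoin_iff {j : I.C₁ ⊗ I.C₁ ⟶ I.C₁} : I.IsJoin j ↔ I.IsConnection I.top I.bot j := by
  constructor
  · rintro ⟨⟨η, rfl⟩, θ, hθ⟩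
    have h₁ := θ.dom
    have h₂ := θ.cod
    rw [hθ, BraidedCategory.braiding_naturality_right_assoc, ← braiding_leftUnitor_assoc,
      cancel_epi] at h₁ h₂
    exact ⟨h₂, by simpa using h₁, η.cod, by simpa using η.dom⟩
  · intro h
    have h' := h.braiding
    exact ⟨⟨⟨_, by simpa using h.one_right, h.zero_right⟩, rfl⟩,
      ⟨_, by simpa using h'.one_right, h'.zero_right⟩, rfl⟩

end Lattice

end StrictInterval

theorem mainTheorem4 {E : Type u} [Category.{v} E] [MonoidalCategory E] [SymmetricCategory E]
    [MonoidalClosed E] [HasFiniteLimits E] [HasFiniteColimits E]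
    (I : StrictInterval E) (hI : I.IsRepresentable) :
    ∃ meet join : I.C₁ ⊗ I.C₁ ⟶ I.C₁,
      (I.IsMeet meet ∧ ∀ m, I.IsMeet m → m = meet) ∧
      (I.IsJoin join ∧ ∀ j, I.IsJoin j → j = join) ∧
      IsCommHopfObject I.C₁ I.bot join I.coid I.comul ∧
      IsCommHopfObject I.C₁ I.top meet I.coid I.comul := by
  obtain ⟨meet, hmeet⟩ := hI.exists_meet
  obtain ⟨join, hjoin⟩ := hI.exists_join
  have hbt : I.IsEndpoints I.bot I.top := .inl ⟨rfl, rfl⟩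
  exact ⟨meet, join,
    ⟨StrictInterval.isMeet_iff.2 hmeet,
      fun m hm => (StrictInterval.isMeet_iff.1 hm).unique hI hbt hmeet⟩,
    ⟨StrictInterval.isJoin_iff.2 hjoin,
      fun j hj => (StrictInterval.isJoin_iff.1 hj).unique hI hbt.symm hjoin⟩,
    hjoin.isCommHopfObject hI hbt.symm, hmeet.isCommHopfObject hI hbt⟩
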